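/- Theorem (structure of the angular response of a reciprocal medium). Let $\kappa>0$ (wavenumber) and $\eta>0$ (intrinsic impedance). For $k=(k_x,k_y)\in\mathbb R^2$ put $k_z(k)=\sqrt{\kappa^2-k_x^2-k_y^2}$ if $k_x^2+k_y^2\le\kappa^2$ and $k_z(k)=i\sqrt{k_x^2+k_y^2-\kappa^2}$ otherwise; let $k_z^{1/2}(k)$ be its square root, taken nonnegative in the first case and equal to $\frac{1+i}{\sqrt2}(k_x^2+k_y^2-\kappa^2)^{1/4}$ in the second. For $r,s\in\mathbb R^3$ and $k,q\in\mathbb R^2$ let $$a_r(k,r)=e^{i(k_xr_x+k_yr_y+k_z(k)r_z)},\qquad a_s(q,s)=e^{-i(q_xs_x+q_ys_y+k_z(q)s_z)}.$$ Let $V_S,V_R\subset\mathbb R^3$ (source and receive volumes) be compact sets with non-empty interior. Let $\mu$ be a measure on $\mathbb R^2\times\mathbb R^2$ that is invariant under $(k,q)\mapsto(-q,-k)$ and does not charge the set where $k_z(k)=0$ or $k_z(q)=0$. (For instance $\mu$ is Lebesgue measure, or its sum with the Lebesgue measure carried by the diagonal $k=q$, in order to include impulsive kernels such as that of free space.) The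 angular response is a function $H_a:\mathbb R^2\times\mathbb R^2\to\mathbb C$, understood as a density with respect to $\mu$. Assume that the channel response $h(r,s)$ at $r\in V_R$ to a point source at $s\in V_S$ has the 4D plane-wave representation $$h(r,s)=\frac1{(2\pi)^2}\int a_r(k,r)\,H_a(k,q)\,a_s(q,s)\,d\mu(k,q),\qquad r\in V_R,\ s\in V_S,$$ and that the channel response $h'(s,r)$ with the roles of source and receiver interchanged is given by the same formula after the interchange of $r$ and $s$ and a change of orientation of the $z$-axis: $$h'(s,r)=\frac1{(2\pi)^2}\int a_r(k,\tilde s)\,H_a(k,q)\,a_s(q,\tilde r)\,d\mu(k,q),\qquad \tilde p=(p_x,p_y,-p_z),$$ both integrals being absolutely convergent for all $r\in V_R$, $s\in V_S$. The medium is reciprocal between $V_S$ and $V_R$ if $$\int_{V_S}j(s)\,e'(s)\,ds=\int_{V_R}j'(r)\,e(r)\,dr\quad\text{for all } j\in L^2(V_S),\ j'\in L^2(V_R),$$ where $e(r)=\int_{V_S}h(r,s)j(s)\,ds$ and $e'(s)=\int_{V_R}h'(s,r)j'(r)\,dr$. Then the medium is reciprocal if and only if the angular response has the form $$H_a(k,q)=\frac{\kappa\eta}{2}\,\frac{K_a(k,q)}{k_z^{1/2}(k)\,k_z^{1/2}(q)}\qquad\text{for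 }\mu\text{-almost every }(k,q)$$ for some complex-symmetric kernel $K_a:\mathbb R^2\times\mathbb R^2\to\mathbb C$, that is, one with $K_a(k,q)=K_a(-q,-k)$ for all $k,q$. -/

import Mathlib

open MeasureTheory Complex

noncomputable section

namespace PlaneWave

/-- Points of physical space, with coordinates `p 0, p 1, p 2` along `x, y, z`. -/
abbrev Space : Type := EuclideanSpace ℝ (Fin 3)

/-- Horizontal wavenumber coordinates `(k_x, k_y)`. -/
abbrev Horiz : Type := EuclideanSpace ℝ (Fin 2)

/-- Longitudinal wavenumber `k_z(k_x, k_y)` for wavenumber `κ`: real and nonnegative on the disk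
`k_x² + k_y² ≤ κ²`, positive imaginary outside (radiation condition). -/
def kz (κ : ℝ) (k : Horiz) : ℂ :=
  if k 0 ^ 2 + k 1 ^ 2 ≤ κ ^ 2 then
    (Real.sqrt (κ ^ 2 - k 0 ^ 2 - k 1 ^ 2) : ℂ)
  else
    I * (Real.sqrt (k 0 ^ 2 + k 1 ^ 2 - κ ^ 2) : ℂ)

/-- The square root `k_z^{1/2}(k_x, k_y)`, with the branch `i^{1/2} = (1 + i)/√2`. -/
def kzSqrt (κ : ℝ) (k : Horiz) : ℂ :=
  if k 0 ^ 2 + k 1 ^ 2 ≤ κ ^ 2 then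
    (Real.sqrt (Real.sqrt (κ ^ 2 - k 0 ^ 2 - k 1 ^ 2)) : ℂ)
  else
    (1 + I) / (Real.sqrt 2 : ℂ) * (Real.sqrt (Real.sqrt (k 0 ^ 2 + k 1 ^ 2 - κ ^ 2)) : ℂ)

/-- Received plane wave `a_r(k, r) = exp(i (k_x r_x + k_y r_y + k_z r_z))`. -/
def recvWave (κ : ℝ) (k : Horiz) (r : Space) : ℂ :=
  Complex.exp (I * (k 0 * r 0 + k 1 * r 1 + kz κ k * r 2))

/-- Source plane wave `a_s(q, s) = exp(-i (q_x s_x + q_y s_y + q_z s_z))`. -/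
def srcWave (κ : ℝ) (q : Horiz) (s : Space) : ℂ :=
  Complex.exp (-I * (q 0 * s 0 + q 1 * s 1 + kz κ q * s 2))

/-- The interchange `(k, q) ↦ (-q, -k)` of receive and source directions. -/
def interchange (p : Horiz × Horiz) : Horiz × Horiz := (-p.2, -p.1)

/-- Complex symmetry of a kernel: `K(k, q) = K(-q, -k)`. -/
def IsComplexSymmetric (K : Horiz → Horiz → ℂ) : Prop :=
  ∀ k q, K k q = K (-q) (-k)

/-- Change of orientation of the `z`-axis: `(x, y, z) ↦ (x, y, -z)`. -/
def flipZ (p : Space) : Space := !₂[p 0, p 1, -(p 2)]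

/-- The integrand `a_r(k, r) H(k, q) a_s(q, s)` of the plane-wave representation. -/
def waveIntegrand (κ : ℝ) (H : Horiz → Horiz → ℂ) (r s : Space) (p : Horiz × Horiz) : ℂ :=
  recvWave κ p.1 r * H p.1 p.2 * srcWave κ p.2 s

/-- The complex number `c` is given at `(r, s)` by the (absolutely convergent) 4D plane-wave
representation `c = (2π)⁻² ∫ a_r(k, r) H(k, q) a_s(q, s) dμ(k, q)`. For `μ = volume` the angular
response is the function `H`; in general it is the generalized function `H dμ`, so that impulsive
responses (such as the free-space one, carried by the diagonal `k = q`) are covered. -/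
def PlaneWaveRep (κ : ℝ) (μ : Measure (Horiz × Horiz)) (H : Horiz → Horiz → ℂ)
    (r s : Space) (c : ℂ) : Prop :=
  Integrable (waveIntegrand κ H r s) μ ∧
    c = 1 / (2 * (Real.pi : ℂ)) ^ 2 * ∫ p, waveIntegrand κ H r s p ∂μ

/-- Field `e(r) = ∫_V h(r, s) j(s) ds` produced by the current density `j` on `V`. -/
def field (V : Set Space) (h : Space → Space → ℂ) (j : Space → ℂ) (r : Space) : ℂ :=
  ∫ s in V, h r s * j s

/-- Reciprocity of the medium between `VS` and `VR`. Here `h r s` is the response at `r ∈ VR` to a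
point source at `s ∈ VS`, and `h' s r` the response at `s ∈ VS` to a point source at `r ∈ VR`:
`∫_{VS} j e' = ∫_{VR} j' e` for all square-integrable currents `j` on `VS` and `j'` on `VR`, with
`e` the field of `j` and `e'` the field of `j'`. -/
def IsReciprocal (VS VR : Set Space) (h h' : Space → Space → ℂ) : Prop :=
  ∀ j j' : Space → ℂ, MemLp j 2 (volume.restrict VS) → MemLp j' 2 (volume.restrict VR) →
    ∫ s in VS, j s * field VR h' j' s = ∫ r in VR, j' r * field VS h j r

end PlaneWave

end

/-!
The measure `μ` is invariant under the interchange `(k, q) ↦ (-q, -k)` and `kz` is even, so the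
representation of the interchanged response `h'(s, r)` is that of `h(r, s)` with `H(k, q)` replaced
by `H(-q, -k)` (`planeWaveRep_flipZ_iff`). The normalizing factor `kzSqrt k * kzSqrt q` is invariant
under the interchange and nonzero `μ`-almost everywhere; hence the kernel `K` exists if and only if
`H(k, q) = H(-q, -k)` almost everywhere (`ae_eq_interchange_iff_exists_isComplexSymmetric`), and it
remains to show that this is equivalent to reciprocity.

On the compact volumes the plane-wave integrands are dominated by a single one, at the lowest
receiver and the highest source. So `h` and `h'` are continuous and bounded on the volumes, and
Fubini's theorem turns reciprocity into the equality of `h(r, s)` and `h'(s, r)` (everywhere on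
the volumes for one implication, in their interiors for the other). This settles the implication
from symmetry to reciprocity.

For the converse, the difference kernel `D(k, q) = H(k, q) - H(-q, -k)` has plane-wave integrals
that vanish for all `r`, `s` in two open sets. Raising the receiver and lowering the source by some
`δ > 0` multiplies the integrand by a factor bounded by a constant times
`exp (-δ (‖k‖ + ‖q‖))`, since waves outside the disk of radius `κ` are evanescent
(`exp_mul_norm_waveIntegrand_le`). At fixed heights the integral is, as a function of the horizontal
positions, the Fourier transform of a density with an exponential moment. Such a transform extends
holomorphically along every line, so it vanishes identically once it vanishes near one point, and
the density is zero by uniqueness of the Fourier transform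
(`ae_eq_zero_of_integral_exp_dual_eq_zero_of_norm_lt`).
-/

namespace PlaneWave

open Filter Topology Set

/-! ### Fourier transforms of densities with an exponential moment -/

section FourierUniqueness

variable {E : Type*} [NormedAddCommGroup E] [NormedSpace ℝ E] [MeasurableSpace E]
  [BorelSpace E] {μ : Measure E}

theorem integrable_exp_dual_mul {f : E → ℂ} (hf : Integrable f μ) (ℓ : StrongDual ℝ E) :
    Integrable (fun p ↦ cexp (ℓ p * I) * f p) μ := by
  refine hf.bdd_mul (c := 1) (Continuous.aestronglyMeasurable (by fun_prop)) ?_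
  exact ae_of_all _ fun p ↦ by rw [norm_exp_ofReal_mul_I]

/-- With an exponential moment of order `δ`, the Fourier transform of `f dμ` along a functional `ℓ`
extends holomorphically to a strip. -/
theorem differentiableOn_integral_exp_mul {f : E → ℂ} {δ : ℝ}
    (hfm : AEStronglyMeasurable f μ)
    (hf : Integrable (fun p ↦ Real.exp (δ * ‖p‖) * ‖f p‖) μ) (ℓ : StrongDual ℝ E) {c : ℝ}
    (hc : 0 < c) (hcℓ : c * ‖ℓ‖ < δ) :
    DifferentiableOn ℂ (fun z : ℂ ↦ ∫ p, cexp (z * (ℓ p * I)) * f p ∂μ) {z | |z.im| < c} := by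
  have hδ : 0 < δ := lt_of_le_of_lt (by positivity) hcℓ
  set ε := δ - c * ‖ℓ‖ with hε
  have hε0 : 0 < ε := by linarith
  have hnorm (z : ℂ) (hz : |z.im| < c) (p : E) :
      ‖cexp (z * (ℓ p * I))‖ ≤ Real.exp (c * ‖ℓ‖ * ‖p‖) := by
    rw [norm_exp]
    refine Real.exp_le_exp.2 ?_
    have h1 : (z * (ℓ p * I)).re = -(z.im * ℓ p) := by simp
    rw [h1]
    calc -(z.im * ℓ p) ≤ |z.im| * |ℓ p| := by rw [← abs_mul]; exact neg_le_abs _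
      _ ≤ c * (‖ℓ‖ * ‖p‖) := by
        gcongr
        exact ℓ.le_opNorm p
      _ = _ := by ring
  have hopen : IsOpen {z : ℂ | |z.im| < c} :=
    isOpen_lt (by fun_prop) continuous_const
  intro z₀ hz₀
  have hm (z : ℂ) : AEStronglyMeasurable (fun p ↦ cexp (z * (ℓ p * I)) * f p) μ :=
    (Continuous.aestronglyMeasurable (by fun_prop)).mul hfm
  refine (hasDerivAt_integral_of_dominated_loc_of_deriv_le
    (F' := fun z p ↦ cexp (z * (ℓ p * I)) * (ℓ p * I) * f p)
    (bound := fun p ↦ ‖ℓ‖ / ε * (Real.exp (δ * ‖p‖) * ‖f p‖))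
    (hopen.mem_nhds hz₀) (Eventually.of_forall hm) ?_ ?_ ?_ (hf.const_mul _)
    ?_).2.differentiableAt.differentiableWithinAt
  · refine hf.mono' (hm z₀) (ae_of_all _ fun p ↦ ?_)
    rw [norm_mul]
    gcongr
    refine (hnorm z₀ hz₀ p).trans ?_
    gcongr
  · exact (Continuous.aestronglyMeasurable (by fun_prop)).mul hfm
  · refine ae_of_all _ fun p z hz ↦ ?_
    rw [norm_mul, norm_mul, norm_mul ((ℓ p : ℝ) : ℂ) I, norm_I, mul_one, norm_real,
      ← mul_assoc (‖ℓ‖ / ε)]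
    refine mul_le_mul_of_nonneg_right ?_ (norm_nonneg (f p))
    -- the part `ε` of the exponent not needed for the exponential absorbs the factor `ℓ p`
    have h2 : ε * ‖p‖ ≤ Real.exp (ε * ‖p‖) := by
      linarith [Real.add_one_le_exp (ε * ‖p‖)]
    calc ‖cexp (z * (ℓ p * I))‖ * ‖ℓ p‖
        ≤ Real.exp (c * ‖ℓ‖ * ‖p‖) * (‖ℓ‖ * ‖p‖) :=
          mul_le_mul (hnorm z hz p) (ℓ.le_opNorm p) (norm_nonneg _) (Real.exp_pos _).le
      _ = ‖ℓ‖ / ε * (Real.exp (c * ‖ℓ‖ * ‖p‖) * (ε * ‖p‖)) := by field_simp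
      _ ≤ ‖ℓ‖ / ε * (Real.exp (c * ‖ℓ‖ * ‖p‖) * Real.exp (ε * ‖p‖)) := by gcongr
      _ = ‖ℓ‖ / ε * Real.exp (δ * ‖p‖) := by
        rw [← Real.exp_add]; congr 2; rw [hε]; ring
  · refine ae_of_all _ fun p z _ ↦ ?_
    have := ((hasDerivAt_id z).mul_const (ℓ p * I : ℂ)).cexp.mul_const (f p)
    simpa using this

variable [CompleteSpace E] [SecondCountableTopology E]

/-- The positive and negative parts of `g` are densities of finite measures with the same
characteristic function. -/
theorem ae_eq_zero_of_forall_integral_exp_dual_eq_zero_real {g : E → ℝ} (hg : Integrable g μ)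
    (h0 : ∀ ℓ : StrongDual ℝ E, ∫ p, cexp (ℓ p * I) * (g p : ℂ) ∂μ = 0) : g =ᵐ[μ] 0 := by
  have key (f : E → ℝ) (hf : Integrable f μ) (ℓ : StrongDual ℝ E) :
      charFunDual (μ.withDensity fun p ↦ ENNReal.ofReal (f p)) ℓ =
        ∫ p, cexp (ℓ p * I) * ((max (f p) 0 : ℝ) : ℂ) ∂μ := by
    rw [charFunDual_apply, integral_withDensity_eq_integral_toReal_smul₀
      hf.aestronglyMeasurable.aemeasurable.ennreal_ofReal
      (ae_of_all _ fun _ ↦ ENNReal.ofReal_lt_top)]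
    refine integral_congr_ae (ae_of_all _ fun p ↦ ?_)
    simp only [ENNReal.toReal_ofReal', Complex.real_smul]
    ring
  have hfin (f : E → ℝ) (hf : Integrable f μ) :
      IsFiniteMeasure (μ.withDensity fun p ↦ ENNReal.ofReal (f p)) :=
    isFiniteMeasure_withDensity_ofReal hf.2
  have := hfin g hg
  have := hfin (fun p ↦ -g p) hg.neg
  have heq : μ.withDensity (fun p ↦ ENNReal.ofReal (g p)) =
      μ.withDensity (fun p ↦ ENNReal.ofReal (-g p)) := by
    refine Measure.ext_of_charFunDual (funext fun ℓ ↦ ?_)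
    rw [key g hg, key (fun p ↦ -g p) hg.neg, ← sub_eq_zero, ← integral_sub]
    · rw [← h0 ℓ]
      refine integral_congr_ae (ae_of_all _ fun p ↦ ?_)
      simp only [← mul_sub, ← ofReal_sub]
      congr 2
      rcases le_total (g p) 0 with h | h
      · rw [max_eq_right h, max_eq_left (by simpa using h)]; ring
      · rw [max_eq_left h, max_eq_right (by simpa using h)]; ring
    · exact integrable_exp_dual_mul hg.pos_part.ofReal ℓ
    · exact integrable_exp_dual_mul hg.neg.pos_part.ofReal ℓ
  have hneg : AEMeasurable (fun p ↦ -g p) μ := hg.aestronglyMeasurable.aemeasurable.neg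
  rw [withDensity_eq_iff hg.aestronglyMeasurable.aemeasurable.ennreal_ofReal
    hneg.ennreal_ofReal hg.lintegral_lt_top.ne] at heq
  filter_upwards [heq] with p hp
  rcases le_total (g p) 0 with h | h
  · rw [ENNReal.ofReal_of_nonpos h, eq_comm, ENNReal.ofReal_eq_zero] at hp
    simp only [Pi.zero_apply]; linarith
  · rw [ENNReal.ofReal_of_nonpos (by linarith : -g p ≤ 0), ENNReal.ofReal_eq_zero] at hp
    simp only [Pi.zero_apply]; linarith

/-- Uniqueness for the Fourier transform of a complex density. -/
theorem ae_eq_zero_of_forall_integral_exp_dual_eq_zero {f : E → ℂ} (hf : Integrable f μ)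
    (h0 : ∀ ℓ : StrongDual ℝ E, ∫ p, cexp (ℓ p * I) * f p ∂μ = 0) : f =ᵐ[μ] 0 := by
  -- conjugating the identity at `-ℓ` shows that the conjugate density has the same property
  have hconj (ℓ : StrongDual ℝ E) :
      ∫ p, cexp (ℓ p * I) * (starRingEnd ℂ) (f p) ∂μ = 0 := by
    have h := congrArg (starRingEnd ℂ) (h0 (-ℓ))
    rw [← integral_conj, map_zero] at h
    rw [← h]
    refine integral_congr_ae (ae_of_all _ fun p ↦ ?_)
    simp [← exp_conj]
  have hcf : Integrable (fun p ↦ (starRingEnd ℂ) (f p)) μ :=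
    conjCLE.toContinuousLinearMap.integrable_comp hf
  have hre : (fun p ↦ (f p).re) =ᵐ[μ] 0 := by
    refine ae_eq_zero_of_forall_integral_exp_dual_eq_zero_real hf.re fun ℓ ↦ ?_
    have h : ∫ p, (cexp (ℓ p * I) * f p + cexp (ℓ p * I) * (starRingEnd ℂ) (f p)) ∂μ = 0 := by
      rw [integral_add (integrable_exp_dual_mul hf ℓ) (integrable_exp_dual_mul hcf ℓ), h0, hconj,
        add_zero]
    rw [← mul_zero (1 / 2 : ℂ), ← h, ← integral_const_mul]
    refine integral_congr_ae (ae_of_all _ fun p ↦ ?_)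
    simp only [← mul_add, add_conj]
    push_cast
    ring
  have him : (fun p ↦ (f p).im) =ᵐ[μ] 0 := by
    refine ae_eq_zero_of_forall_integral_exp_dual_eq_zero_real hf.im fun ℓ ↦ ?_
    have h : ∫ p, (cexp (ℓ p * I) * f p - cexp (ℓ p * I) * (starRingEnd ℂ) (f p)) ∂μ = 0 := by
      rw [integral_sub (integrable_exp_dual_mul hf ℓ) (integrable_exp_dual_mul hcf ℓ), h0, hconj,
        sub_zero]
    rw [← mul_zero (-I / 2 : ℂ), ← h, ← integral_const_mul]
    refine integral_congr_ae (ae_of_all _ fun p ↦ ?_)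
    simp only [← mul_sub, sub_conj]
    push_cast
    linear_combination cexp (ℓ p * I) * (f p).im * I_sq
  filter_upwards [hre, him] with p h1 h2
  exact Complex.ext h1 h2

/-- A density with an exponential moment vanishes as soon as its Fourier transform vanishes on a
neighbourhood of the origin: restricted to each line through the origin, the transform is
holomorphic on a strip, so the identity theorem makes it vanish everywhere. -/
theorem ae_eq_zero_of_integral_exp_dual_eq_zero_of_norm_lt {f : E → ℂ} {δ ρ : ℝ} (hδ : 0 < δ)
    (hρ : 0 < ρ) (hfm : AEStronglyMeasurable f μ)
    (hf : Integrable (fun p ↦ Real.exp (δ * ‖p‖) * ‖f p‖) μ)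
    (h0 : ∀ ℓ : StrongDual ℝ E, ‖ℓ‖ < ρ → ∫ p, cexp (ℓ p * I) * f p ∂μ = 0) : f =ᵐ[μ] 0 := by
  have hfi : Integrable f μ := hf.mono' hfm (ae_of_all _ fun p ↦
    le_mul_of_one_le_left (norm_nonneg _) (Real.one_le_exp (by positivity)))
  refine ae_eq_zero_of_forall_integral_exp_dual_eq_zero hfi fun ℓ ↦ ?_
  set c := δ / (‖ℓ‖ + 1) with hc
  have hc0 : 0 < c := by positivity
  have hcℓ : c * ‖ℓ‖ < δ := by
    rw [hc, div_mul_eq_mul_div, div_lt_iff₀ (by positivity)]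
    nlinarith [norm_nonneg ℓ]
  have hopen : IsOpen {z : ℂ | |z.im| < c} := isOpen_lt (by fun_prop) continuous_const
  have hconv : Convex ℝ {z : ℂ | |z.im| < c} := by
    have : {z : ℂ | |z.im| < c} = imLm ⁻¹' Metric.ball 0 c := by ext; simp
    rw [this]
    exact (convex_ball _ _).linear_preimage _
  have han := (differentiableOn_integral_exp_mul hfm hf ℓ hc0 hcℓ).analyticOnNhd hopen
  have hfreq : ∃ᶠ z in 𝓝[≠] (0 : ℂ), ∫ p, cexp (z * (ℓ p * I)) * f p ∂μ = 0 := by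
    have ht : Tendsto (fun t : ℝ ↦ (t : ℂ)) (𝓝[≠] 0) (𝓝[≠] 0) := by
      refine tendsto_nhdsWithin_iff.2 ⟨?_, ?_⟩
      · exact (continuous_ofReal.tendsto' 0 0 ofReal_zero).mono_left nhdsWithin_le_nhds
      · filter_upwards [self_mem_nhdsWithin] with t ht
        simpa using ht
    refine ht.frequently (Eventually.frequently ?_)
    have hlim : Tendsto (fun t : ℝ ↦ ‖t • ℓ‖) (𝓝[≠] 0) (𝓝 0) :=
      (Continuous.tendsto' (by fun_prop) 0 0 (by simp)).mono_left nhdsWithin_le_nhds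
    filter_upwards [hlim.eventually_lt_const hρ] with t ht
    rw [← h0 _ ht]
    refine integral_congr_ae (ae_of_all _ fun p ↦ ?_)
    simp [mul_assoc]
  have := han.eqOn_zero_of_preconnected_of_frequently_eq_zero hconv.isPreconnected
    (by simpa using hc0) hfreq (show (1 : ℂ) ∈ {z : ℂ | |z.im| < c} by simpa using hc0)
  simpa using this

end FourierUniqueness

/-! ### Plane waves and the longitudinal wavenumber -/

theorem kz_im_nonneg (κ : ℝ) (k : Horiz) : 0 ≤ (kz κ k).im := by
  unfold kz
  split_ifs
  · simp
  · simp [Real.sqrt_nonneg]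

theorem norm_le_kz_im_add {κ : ℝ} (hκ : 0 ≤ κ) (k : Horiz) : ‖k‖ ≤ (kz κ k).im + κ := by
  have hk : ‖k‖ ^ 2 = k 0 ^ 2 + k 1 ^ 2 := by
    simp [EuclideanSpace.norm_sq_eq, Fin.sum_univ_two]
  refine abs_le_of_sq_le_sq' ?_ (add_nonneg (kz_im_nonneg κ k) hκ) |>.2
  unfold kz
  split_ifs with h
  · simpa [hk] using h
  · have h0 : 0 ≤ k 0 ^ 2 + k 1 ^ 2 - κ ^ 2 := by linarith
    have h1 := Real.sq_sqrt h0
    have h2 := Real.sqrt_nonneg (k 0 ^ 2 + k 1 ^ 2 - κ ^ 2)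
    simp only [mul_im, I_re, ofReal_im, mul_zero, I_im, ofReal_re, one_mul, zero_add]
    nlinarith [mul_nonneg h2 hκ]

@[simp]
theorem kz_neg (κ : ℝ) (k : Horiz) : kz κ (-k) = kz κ k := by
  simp [kz]

@[simp]
theorem kzSqrt_neg (κ : ℝ) (k : Horiz) : kzSqrt κ (-k) = kzSqrt κ k := by
  simp [kzSqrt]

theorem kzSqrt_ne_zero {κ : ℝ} {k : Horiz} (h : kz κ k ≠ 0) : kzSqrt κ k ≠ 0 := by
  have hI : (1 + I : ℂ) ≠ 0 := fun h ↦ by simpa using congrArg Complex.im h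
  unfold kz at h
  unfold kzSqrt
  split_ifs with hk
  · rw [if_pos hk, ofReal_ne_zero] at h
    rw [ofReal_ne_zero]
    exact (Real.sqrt_pos.2 (lt_of_le_of_ne (Real.sqrt_nonneg _) h.symm)).ne'
  · have h0 : 0 < k 0 ^ 2 + k 1 ^ 2 - κ ^ 2 := by linarith
    refine mul_ne_zero (div_ne_zero hI ?_) ?_
    · simp
    · rw [ofReal_ne_zero]
      exact (Real.sqrt_pos.2 (Real.sqrt_pos.2 h0)).ne'

theorem norm_recvWave (κ : ℝ) (k : Horiz) (r : Space) :
    ‖recvWave κ k r‖ = Real.exp (-((kz κ k).im * r 2)) := by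
  rw [recvWave, norm_exp]
  simp

theorem norm_srcWave (κ : ℝ) (q : Horiz) (s : Space) :
    ‖srcWave κ q s‖ = Real.exp ((kz κ q).im * s 2) := by
  rw [srcWave, norm_exp]
  simp

/-- Raising the receiver and lowering the source by `δ` damps every evanescent wave, and yields an
exponential moment of order `δ` for the integrand. -/
theorem exp_mul_norm_waveIntegrand_le {κ δ : ℝ} (hκ : 0 ≤ κ) (hδ : 0 ≤ δ)
    (H : Horiz → Horiz → ℂ) {r r' s s' : Space} (hr : r' 2 + δ ≤ r 2) (hs : s 2 + δ ≤ s' 2)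
    (p : Horiz × Horiz) :
    Real.exp (δ * ‖p‖) * ‖waveIntegrand κ H r s p‖ ≤
      Real.exp (2 * δ * κ) * ‖waveIntegrand κ H r' s' p‖ := by
  have h1 := kz_im_nonneg κ p.1
  have h2 := kz_im_nonneg κ p.2
  have hp : ‖p‖ ≤ ‖p.1‖ + ‖p.2‖ := max_le_add_of_nonneg (norm_nonneg _) (norm_nonneg _)
  have h3 : δ * ‖p‖ ≤ δ * ((kz κ p.1).im + κ + ((kz κ p.2).im + κ)) := by
    refine mul_le_mul_of_nonneg_left (hp.trans ?_) hδ
    exact add_le_add (norm_le_kz_im_add hκ _) (norm_le_kz_im_add hκ _)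
  have h4 := mul_le_mul_of_nonneg_left hr h1
  have h5 := mul_le_mul_of_nonneg_left hs h2
  have key : Real.exp (δ * ‖p‖) * Real.exp (-((kz κ p.1).im * r 2)) *
      Real.exp ((kz κ p.2).im * s 2) ≤ Real.exp (2 * δ * κ) *
      Real.exp (-((kz κ p.1).im * r' 2)) * Real.exp ((kz κ p.2).im * s' 2) := by
    simp only [← Real.exp_add]
    refine Real.exp_le_exp.2 ?_
    linarith
  simp only [waveIntegrand, norm_mul, norm_recvWave, norm_srcWave]
  calc _ = Real.exp (δ * ‖p‖) * Real.exp (-((kz κ p.1).im * r 2)) *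
      Real.exp ((kz κ p.2).im * s 2) * ‖H p.1 p.2‖ := by ring
    _ ≤ _ := mul_le_mul_of_nonneg_right key (norm_nonneg _)
    _ = _ := by ring

theorem norm_waveIntegrand_le {κ : ℝ} (H : Horiz → Horiz → ℂ) {r r' s s' : Space}
    (hr : r' 2 ≤ r 2) (hs : s 2 ≤ s' 2) (p : Horiz × Horiz) :
    ‖waveIntegrand κ H r s p‖ ≤ ‖waveIntegrand κ H r' s' p‖ := by
  simp only [waveIntegrand, norm_mul, norm_recvWave, norm_srcWave]
  have h1 := kz_im_nonneg κ p.1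
  have h2 := kz_im_nonneg κ p.2
  gcongr

/-- A horizontal displacement of the receiver and the source multiplies the integrand by a
unimodular character of the wavenumbers. -/
theorem waveIntegrand_of_horizontal_shift (κ : ℝ) (H : Horiz → Horiz → ℂ) {r r' s s' : Space}
    (ℓ : StrongDual ℝ (Horiz × Horiz))
    (hr0 : r' 0 = r 0 + ℓ (EuclideanSpace.single 0 1, 0))
    (hr1 : r' 1 = r 1 + ℓ (EuclideanSpace.single 1 1, 0)) (hr2 : r' 2 = r 2)
    (hs0 : s' 0 = s 0 - ℓ (0, EuclideanSpace.single 0 1))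
    (hs1 : s' 1 = s 1 - ℓ (0, EuclideanSpace.single 1 1)) (hs2 : s' 2 = s 2)
    (p : Horiz × Horiz) :
    waveIntegrand κ H r' s' p = cexp (ℓ p * I) * waveIntegrand κ H r s p := by
  have hv (v : Horiz) : v = v 0 • EuclideanSpace.single 0 1 + v 1 • EuclideanSpace.single 1 1 := by
    ext i
    fin_cases i <;> simp
  have hℓ : ℓ p = p.1 0 * ℓ (EuclideanSpace.single 0 1, 0) +
      p.1 1 * ℓ (EuclideanSpace.single 1 1, 0) + (p.2 0 * ℓ (0, EuclideanSpace.single 0 1) +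
      p.2 1 * ℓ (0, EuclideanSpace.single 1 1)) := by
    have hp : p = (p.1 0 • (EuclideanSpace.single 0 1, 0) +
        p.1 1 • (EuclideanSpace.single 1 1, 0)) + (p.2 0 • (0, EuclideanSpace.single 0 1) +
        p.2 1 • (0, EuclideanSpace.single 1 1)) := by
      refine Prod.ext ?_ ?_
      · simpa using hv p.1
      · simpa using hv p.2
    conv_lhs => rw [hp]
    simp only [map_add, map_smul, smul_eq_mul]
  have hexp : recvWave κ p.1 r' * srcWave κ p.2 s' =
      cexp (ℓ p * I) * (recvWave κ p.1 r * srcWave κ p.2 s) := by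
    simp only [recvWave, srcWave, ← Complex.exp_add, hℓ, hr0, hr1, hr2, hs0, hs1, hs2]
    congr 1
    push_cast
    ring
  simp only [waveIntegrand]
  linear_combination H p.1 p.2 * hexp

/-! ### Interchange of source and receiver -/

/-- Interchanging source and receiver, with the `z`-axis reversed, amounts to replacing the kernel
`H(k, q)` by `H(-q, -k)`. -/
theorem waveIntegrand_flipZ (κ : ℝ) (H : Horiz → Horiz → ℂ) (r s : Space) :
    waveIntegrand κ H (flipZ s) (flipZ r) =
      waveIntegrand κ (fun k q ↦ H (-q) (-k)) r s ∘ interchange := by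
  funext p
  have hexp : recvWave κ p.1 (flipZ s) * srcWave κ p.2 (flipZ r) =
      recvWave κ (-p.2) r * srcWave κ (-p.1) s := by
    simp only [recvWave, srcWave, ← Complex.exp_add, flipZ, kz_neg]
    congr 1
    simp
    ring
  simp only [waveIntegrand, Function.comp_apply, interchange, neg_neg]
  linear_combination H p.1 p.2 * hexp

theorem interchange_interchange (p : Horiz × Horiz) : interchange (interchange p) = p := by
  simp [interchange]

theorem measurableEmbedding_interchange : MeasurableEmbedding interchange := by
  have hm : Measurable interchange := by unfold interchange; fun_prop
  exact (⟨⟨interchange, interchange, interchange_interchange, interchange_interchange⟩, hm, hm⟩ :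
    (Horiz × Horiz) ≃ᵐ (Horiz × Horiz)).measurableEmbedding

variable {κ : ℝ} {μ : Measure (Horiz × Horiz)} {H : Horiz → Horiz → ℂ}

theorem planeWaveRep_flipZ_iff (hμ : MeasurePreserving interchange μ μ) {r s : Space} {c : ℂ} :
    PlaneWaveRep κ μ H (flipZ s) (flipZ r) c ↔
      PlaneWaveRep κ μ (fun k q ↦ H (-q) (-k)) r s c := by
  unfold PlaneWaveRep
  rw [waveIntegrand_flipZ, hμ.integrable_comp_emb measurableEmbedding_interchange]
  simp only [Function.comp_apply]
  rw [hμ.integral_comp measurableEmbedding_interchange]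

/-! ### Reciprocity as equality of the channel responses -/

theorem continuous_waveIntegrand (κ : ℝ) (H : Horiz → Horiz → ℂ) (p : Horiz × Horiz) :
    Continuous fun x : Space × Space ↦ waveIntegrand κ H x.1 x.2 p := by
  unfold waveIntegrand recvWave srcWave
  fun_prop

/-- Compactness of the volumes makes the representation converge uniformly: the integrand is largest
at the lowest receiver and the highest source. -/
theorem continuousOn_of_planeWaveRep {VS VR : Set Space} (hVS : IsCompact VS) (hVR : IsCompact VR)
    {h : Space → Space → ℂ} (hrep : ∀ r ∈ VR, ∀ s ∈ VS, PlaneWaveRep κ μ H r s (h r s)) :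
    ContinuousOn (fun x : Space × Space ↦ h x.1 x.2) (VR ×ˢ VS) := by
  rcases VR.eq_empty_or_nonempty with rfl | hR
  · simp
  rcases VS.eq_empty_or_nonempty with rfl | hS
  · simp
  have hc : Continuous fun r : Space ↦ r 2 := by fun_prop
  obtain ⟨r₀, hr₀, hmin⟩ := hVR.exists_isMinOn hR hc.continuousOn
  obtain ⟨s₀, hs₀, hmax⟩ := hVS.exists_isMaxOn hS hc.continuousOn
  have hcont : ContinuousOn (fun x : Space × Space ↦ 1 / (2 * (Real.pi : ℂ)) ^ 2 *
      ∫ p, waveIntegrand κ H x.1 x.2 p ∂μ) (VR ×ˢ VS) := by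
    refine continuousOn_const.mul ?_
    refine continuousOn_of_dominated (bound := fun p ↦ ‖waveIntegrand κ H r₀ s₀ p‖) ?_ ?_
      (hrep r₀ hr₀ s₀ hs₀).1.norm ?_
    · exact fun x hx ↦ (hrep x.1 hx.1 x.2 hx.2).1.aestronglyMeasurable
    · exact fun x hx ↦ ae_of_all _ (norm_waveIntegrand_le H (hmin hx.1) (hmax hx.2))
    · exact ae_of_all _ fun p ↦ (continuous_waveIntegrand κ H p).continuousOn
  exact hcont.congr fun x hx ↦ (hrep x.1 hx.1 x.2 hx.2).2

section Reciprocity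

variable {VS VR : Set Space} {h h' : Space → Space → ℂ} {j j' : Space → ℂ}

theorem integrable_mul_mul_prod (hVS : IsCompact VS) (hVR : IsCompact VR)
    {g : Space × Space → ℂ} (hg : ContinuousOn g (VR ×ˢ VS))
    (hj : MemLp j 2 (volume.restrict VS)) (hj' : MemLp j' 2 (volume.restrict VR)) :
    Integrable (fun x : Space × Space ↦ g x * (j' x.1 * j x.2))
      ((volume.restrict VR).prod (volume.restrict VS)) := by
  have : IsFiniteMeasure (volume.restrict VS) := ⟨by simpa using hVS.measure_lt_top⟩
  have : IsFiniteMeasure (volume.restrict VR) := ⟨by simpa using hVR.measure_lt_top⟩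
  have hm : MeasurableSet (VR ×ˢ VS) := hVR.measurableSet.prod hVS.measurableSet
  obtain ⟨C, hC⟩ := (hVR.prod hVS).exists_bound_of_continuousOn hg
  refine ((hj'.integrable one_le_two).mul_prod (hj.integrable one_le_two)).bdd_mul (c := C) ?_ ?_
  · rw [Measure.prod_restrict]
    exact hg.aestronglyMeasurable hm
  · rw [Measure.prod_restrict]
    filter_upwards [ae_restrict_mem hm] with x hx using hC x hx

/-- By Fubini's theorem, reciprocity is an identity between integrals over `VR × VS`. -/
theorem isReciprocal_iff_integral_prod (hVS : IsCompact VS) (hVR : IsCompact VR)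
    (hh : ContinuousOn (fun x : Space × Space ↦ h x.1 x.2) (VR ×ˢ VS))
    (hh' : ContinuousOn (fun x : Space × Space ↦ h' x.2 x.1) (VR ×ˢ VS)) :
    IsReciprocal VS VR h h' ↔ ∀ j j' : Space → ℂ, MemLp j 2 (volume.restrict VS) →
      MemLp j' 2 (volume.restrict VR) →
      ∫ x, h' x.2 x.1 * (j' x.1 * j x.2) ∂(volume.restrict VR).prod (volume.restrict VS) =
        ∫ x, h x.1 x.2 * (j' x.1 * j x.2) ∂(volume.restrict VR).prod (volume.restrict VS) := by
  unfold IsReciprocal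
  refine forall₄_congr fun j j' hj hj' ↦ ?_
  rw [integral_prod _ (integrable_mul_mul_prod hVS hVR hh hj hj'),
    integral_prod_symm _ (integrable_mul_mul_prod hVS hVR hh' hj hj')]
  unfold field
  simp only [← integral_const_mul]
  have e1 : ∀ r s, j s * (h' s r * j' r) = h' s r * (j' r * j s) := fun r s ↦ by ring
  have e2 : ∀ r s, j' r * (h r s * j s) = h r s * (j' r * j s) := fun r s ↦ by ring
  simp only [e1, e2]

theorem isReciprocal_of_eq (hVS : IsCompact VS) (hVR : IsCompact VR)
    (hh : ContinuousOn (fun x : Space × Space ↦ h x.1 x.2) (VR ×ˢ VS))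
    (heq : ∀ r ∈ VR, ∀ s ∈ VS, h r s = h' s r) : IsReciprocal VS VR h h' := by
  have hh' : ContinuousOn (fun x : Space × Space ↦ h' x.2 x.1) (VR ×ˢ VS) :=
    hh.congr fun x hx ↦ (heq x.1 hx.1 x.2 hx.2).symm
  rw [isReciprocal_iff_integral_prod hVS hVR hh hh']
  intro j j' _ _
  rw [Measure.prod_restrict]
  refine setIntegral_congr_fun (hVR.measurableSet.prod hVS.measurableSet) fun x hx ↦ ?_
  simp only [heq x.1 hx.1 x.2 hx.2]

/-- Testing reciprocity with the indicators of small neighbourhoods shows that the two channel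
responses agree in the interior of the volumes, where they are continuous. -/
theorem IsReciprocal.eq_of_mem_interior (hrec : IsReciprocal VS VR h h')
    (hVS : IsCompact VS) (hVR : IsCompact VR)
    (hh : ContinuousOn (fun x : Space × Space ↦ h x.1 x.2) (VR ×ˢ VS))
    (hh' : ContinuousOn (fun x : Space × Space ↦ h' x.2 x.1) (VR ×ˢ VS))
    {r s : Space} (hr : r ∈ interior VR) (hs : s ∈ interior VS) : h r s = h' s r := by
  rw [isReciprocal_iff_integral_prod hVS hVR hh hh'] at hrec
  by_contra hne
  set d : Space × Space → ℂ := fun x ↦ h x.1 x.2 - h' x.2 x.1 with hd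
  have hdc : ContinuousOn d (VR ×ˢ VS) := hh.sub hh'
  have hd0 : 0 < ‖d (r, s)‖ := norm_pos_iff.2 (sub_ne_zero.2 hne)
  have hat : ContinuousAt d (r, s) := hdc.continuousAt
    (prod_mem_nhds (mem_interior_iff_mem_nhds.1 hr) (mem_interior_iff_mem_nhds.1 hs))
  have hnear : {x | ‖d x - d (r, s)‖ < ‖d (r, s)‖ / 2} ∩ interior VR ×ˢ interior VS ∈
      𝓝 (r, s) := by
    refine inter_mem ?_ (prod_mem_nhds (isOpen_interior.mem_nhds hr)
      (isOpen_interior.mem_nhds hs))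
    have := hat.eventually (Metric.ball_mem_nhds _ (half_pos hd0))
    filter_upwards [this] with x hx
    simpa [dist_eq_norm] using hx
  obtain ⟨A, B, hAo, hrA, hBo, hsB, hAB⟩ := mem_nhds_prod_iff'.1 hnear
  have hAR : A ⊆ VR := fun x hx ↦ interior_subset (hAB (show (x, s) ∈ A ×ˢ B from ⟨hx, hsB⟩)).2.1
  have hBS : B ⊆ VS := fun x hx ↦ interior_subset (hAB (show (r, x) ∈ A ×ˢ B from ⟨hrA, hx⟩)).2.2
  have hind {V W : Set Space} (hV : IsCompact V) (hW : IsOpen W) :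
      MemLp (W.indicator fun _ ↦ (1 : ℂ)) 2 (volume.restrict V) := by
    refine memLp_indicator_const 2 hW.measurableSet 1 (Or.inr ?_)
    rw [Measure.restrict_apply hW.measurableSet]
    exact ((measure_mono inter_subset_right).trans_lt hV.measure_lt_top).ne
  have hjB := hind hVS hBo
  have hjA := hind hVR hAo
  have hzero : ∫ x in A ×ˢ B, d x = 0 := by
    have h0 := sub_eq_zero.2 (hrec _ _ hjB hjA).symm
    rw [← integral_sub (integrable_mul_mul_prod hVS hVR hh hjB hjA)
      (integrable_mul_mul_prod hVS hVR hh' hjB hjA)] at h0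
    have hfun : (fun x : Space × Space ↦
        h x.1 x.2 * (A.indicator (fun _ ↦ (1 : ℂ)) x.1 * B.indicator (fun _ ↦ (1 : ℂ)) x.2) -
        h' x.2 x.1 * (A.indicator (fun _ ↦ (1 : ℂ)) x.1 * B.indicator (fun _ ↦ (1 : ℂ)) x.2)) =
        (A ×ˢ B).indicator d := by
      funext x
      by_cases h1 : x.1 ∈ A <;> by_cases h2 : x.2 ∈ B <;> simp [indicator, h1, h2, hd]
    rw [hfun, Measure.prod_restrict,
      setIntegral_indicator (hAo.prod hBo).measurableSet, ← Measure.volume_eq_prod,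
      inter_eq_right.2 (prod_mono hAR hBS)] at h0
    exact h0
  have hfin : volume (A ×ˢ B) < ⊤ :=
    (measure_mono (prod_mono hAR hBS)).trans_lt (hVR.prod hVS).measure_lt_top
  have hpos : 0 < volume.real (A ×ˢ B) :=
    ENNReal.toReal_pos ((hAo.prod hBo).measure_pos volume ⟨(r, s), hrA, hsB⟩).ne' hfin.ne
  have hle : ‖∫ x in A ×ˢ B, (d x - d (r, s))‖ ≤ ‖d (r, s)‖ / 2 * volume.real (A ×ˢ B) :=
    norm_setIntegral_le_of_norm_le_const hfin fun x hx ↦ (hAB hx).1.le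
  have hint : IntegrableOn d (A ×ˢ B) :=
    (hdc.integrableOn_compact (hVR.prod hVS)).mono_set (prod_mono hAR hBS)
  rw [integral_sub hint (integrableOn_const hfin.ne), hzero, setIntegral_const, zero_sub, norm_neg,
    norm_smul, Real.norm_of_nonneg hpos.le] at hle
  nlinarith [mul_pos hd0 hpos]

end Reciprocity

/-! ### Uniqueness and symmetrization of the angular response -/

/-- A kernel whose plane-wave integrals vanish for all receivers and sources in two open sets is
null. -/
theorem ae_eq_zero_of_integral_waveIntegrand_eq_zero (hκ : 0 ≤ κ) {U W : Set Space}
    (hU : IsOpen U) (hW : IsOpen W) (hU0 : U.Nonempty) (hW0 : W.Nonempty)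
    (hint : ∀ r ∈ U, ∀ s ∈ W, Integrable (waveIntegrand κ H r s) μ)
    (hzero : ∀ r ∈ U, ∀ s ∈ W, ∫ p, waveIntegrand κ H r s p ∂μ = 0) :
    ∀ᵐ p ∂μ, H p.1 p.2 = 0 := by
  obtain ⟨r₀, hr₀⟩ := hU0
  obtain ⟨s₀, hs₀⟩ := hW0
  -- the receiver is raised, the source lowered, by `t`, and both move horizontally along `ℓ`
  let R : ℝ × StrongDual ℝ (Horiz × Horiz) → Space := fun x ↦
    r₀ + !₂[x.2 (EuclideanSpace.single 0 1, 0), x.2 (EuclideanSpace.single 1 1, 0), x.1]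
  let S : ℝ × StrongDual ℝ (Horiz × Horiz) → Space := fun x ↦
    s₀ - !₂[x.2 (0, EuclideanSpace.single 0 1), x.2 (0, EuclideanSpace.single 1 1), x.1]
  have hRc : Continuous R := by
    refine continuous_const.add ((PiLp.continuous_toLp 2 _).comp (continuous_pi fun i ↦ ?_))
    fin_cases i <;> simp <;> fun_prop
  have hSc : Continuous S := by
    refine continuous_const.sub ((PiLp.continuous_toLp 2 _).comp (continuous_pi fun i ↦ ?_))
    fin_cases i <;> simp <;> fun_prop
  have hR0 : R 0 = r₀ := by
    ext i
    fin_cases i <;> simp [R]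
  have hS0 : S 0 = s₀ := by
    ext i
    fin_cases i <;> simp [S]
  have hev : ∀ᶠ x in 𝓝 (0 : ℝ × StrongDual ℝ (Horiz × Horiz)), R x ∈ U ∧ S x ∈ W :=
    (hRc.continuousAt.eventually_mem (hU.mem_nhds (hR0 ▸ hr₀))).and
      (hSc.continuousAt.eventually_mem (hW.mem_nhds (hS0 ▸ hs₀)))
  obtain ⟨ε, hε, hball⟩ := Metric.eventually_nhds_iff.1 hev
  have hmem (ℓ : StrongDual ℝ (Horiz × Horiz)) (hℓ : ‖ℓ‖ < ε) :
      R (ε / 2, ℓ) ∈ U ∧ S (ε / 2, ℓ) ∈ W := by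
    refine hball ?_
    rw [dist_zero_right, Prod.norm_def]
    refine max_lt ?_ hℓ
    simp only [Real.norm_eq_abs, abs_of_pos (half_pos hε)]
    linarith
  have h0 := hmem 0 (by simpa using hε)
  have hf : waveIntegrand κ H (R (ε / 2, 0)) (S (ε / 2, 0)) =ᵐ[μ] 0 := by
    have hm := (hint _ h0.1 _ h0.2).aestronglyMeasurable
    refine ae_eq_zero_of_integral_exp_dual_eq_zero_of_norm_lt (half_pos hε) hε hm ?_ ?_
    · refine ((hint r₀ hr₀ s₀ hs₀).norm.const_mul (Real.exp (2 * (ε / 2) * κ))).mono'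
        ((Continuous.aestronglyMeasurable (by fun_prop)).mul hm.norm) (ae_of_all _ fun p ↦ ?_)
      rw [Real.norm_of_nonneg (by positivity)]
      exact exp_mul_norm_waveIntegrand_le hκ (half_pos hε).le H (by simp [R]) (by simp [S]) p
    · intro ℓ hℓ
      rw [← hzero _ (hmem ℓ hℓ).1 _ (hmem ℓ hℓ).2]
      refine integral_congr_ae (ae_of_all _ fun p ↦ ?_)
      refine (waveIntegrand_of_horizontal_shift κ H ℓ ?_ ?_ ?_ ?_ ?_ ?_ p).symm <;> simp [R, S]
  filter_upwards [hf] with p hp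
  simpa [waveIntegrand, recvWave, srcWave, Complex.exp_ne_zero] using hp

/-- An angular response is a normalized complex-symmetric kernel exactly when it is, up to a null
set, invariant under the interchange. Averaging over the interchange yields a kernel that is symmetric
everywhere, not just almost everywhere. -/
theorem ae_eq_interchange_iff_exists_isComplexSymmetric {c : ℂ} (hc : c ≠ 0)
    (hμ : MeasurePreserving interchange μ μ)
    (hμ0 : ∀ᵐ p ∂μ, kz κ p.1 ≠ 0 ∧ kz κ p.2 ≠ 0) :
    (∀ᵐ p ∂μ, H p.1 p.2 = H (-p.2) (-p.1)) ↔
      ∃ K : Horiz → Horiz → ℂ, IsComplexSymmetric K ∧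
        ∀ᵐ p ∂μ, H p.1 p.2 = c * (K p.1 p.2 / (kzSqrt κ p.1 * kzSqrt κ p.2)) := by
  constructor
  · intro h
    refine ⟨fun k q ↦ kzSqrt κ k * kzSqrt κ q * (H k q + H (-q) (-k)) / (2 * c), ?_, ?_⟩
    · intro k q
      simp only [kzSqrt_neg, neg_neg]
      ring
    · filter_upwards [h, hμ0] with p hp hp0
      have h1 := kzSqrt_ne_zero hp0.1
      have h2 := kzSqrt_ne_zero hp0.2
      simp only [← hp]
      field_simp
      ring
  · rintro ⟨K, hK, h⟩
    filter_upwards [h, hμ.quasiMeasurePreserving.ae h] with p hp hp'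
    simp only [interchange, kzSqrt_neg] at hp'
    rw [hp, hp', hK p.1 p.2, mul_comm (kzSqrt κ p.1)]

end PlaneWave

theorem theorem1
    (κ η : ℝ) (hκ : 0 < κ) (hη : 0 < η)
    -- source and receive volumes
    (VS VR : Set PlaneWave.Space) (hVS : IsCompact VS) (hVR : IsCompact VR)
    (hVS' : (interior VS).Nonempty) (hVR' : (interior VR).Nonempty)
    -- reference measure for the angular response (for instance Lebesgue measure)
    (μ : MeasureTheory.Measure (PlaneWave.Horiz × PlaneWave.Horiz))
    (hμ : MeasureTheory.MeasurePreserving PlaneWave.interchange μ μ)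
    (hμ0 : ∀ᵐ p ∂μ, PlaneWave.kz κ p.1 ≠ 0 ∧ PlaneWave.kz κ p.2 ≠ 0)
    -- angular response, channel response, and channel response with the roles interchanged
    (Ha : PlaneWave.Horiz → PlaneWave.Horiz → ℂ)
    (h h' : PlaneWave.Space → PlaneWave.Space → ℂ)
    (hrep : ∀ r ∈ VR, ∀ s ∈ VS, PlaneWave.PlaneWaveRep κ μ Ha r s (h r s))
    -- with the roles interchanged the waves travel along `-z`: the orientation of the z-axis changes
    (hrep' : ∀ r ∈ VR, ∀ s ∈ VS,
      PlaneWave.PlaneWaveRep κ μ Ha (PlaneWave.flipZ s) (PlaneWave.flipZ r) (h' s r)) :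
    PlaneWave.IsReciprocal VS VR h h' ↔
      ∃ Ka : PlaneWave.Horiz → PlaneWave.Horiz → ℂ,
        PlaneWave.IsComplexSymmetric Ka ∧
        ∀ᵐ p ∂μ, Ha p.1 p.2 =
          ((κ : ℂ) * (η : ℂ) / 2) * (Ka p.1 p.2 /
            (PlaneWave.kzSqrt κ p.1 * PlaneWave.kzSqrt κ p.2)) := by
  have hc : (κ : ℂ) * (η : ℂ) / 2 ≠ 0 := by
    simp [hκ.ne', hη.ne']
  rw [← PlaneWave.ae_eq_interchange_iff_exists_isComplexSymmetric hc hμ hμ0]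
  have hrepT : ∀ r ∈ VR, ∀ s ∈ VS,
      PlaneWave.PlaneWaveRep κ μ (fun k q ↦ Ha (-q) (-k)) r s (h' s r) := fun r hr s hs ↦
    (PlaneWave.planeWaveRep_flipZ_iff hμ).1 (hrep' r hr s hs)
  have hh := PlaneWave.continuousOn_of_planeWaveRep hVS hVR hrep
  have hh' := PlaneWave.continuousOn_of_planeWaveRep (h := fun r s ↦ h' s r) hVS hVR hrepT
  constructor
  · intro hrec
    have hD (r s : PlaneWave.Space) :
        PlaneWave.waveIntegrand κ (fun k q ↦ Ha k q - Ha (-q) (-k)) r s =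
          PlaneWave.waveIntegrand κ Ha r s -
            PlaneWave.waveIntegrand κ (fun k q ↦ Ha (-q) (-k)) r s := by
      funext p
      simp only [PlaneWave.waveIntegrand, Pi.sub_apply]
      ring
    have hae := PlaneWave.ae_eq_zero_of_integral_waveIntegrand_eq_zero (κ := κ) (μ := μ)
      (H := fun k q ↦ Ha k q - Ha (-q) (-k)) hκ.le isOpen_interior isOpen_interior hVR' hVS'
      (fun r hr s hs ↦ by
        rw [hD]
        exact (hrep r (interior_subset hr) s (interior_subset hs)).1.sub
          (hrepT r (interior_subset hr) s (interior_subset hs)).1)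
      (fun r hr s hs ↦ by
        have h1 := hrep r (interior_subset hr) s (interior_subset hs)
        have h2 := hrepT r (interior_subset hr) s (interior_subset hs)
        have heq := hrec.eq_of_mem_interior hVS hVR hh hh' hr hs
        rw [h1.2, h2.2] at heq
        rw [hD, integral_sub' h1.1 h2.1, sub_eq_zero]
        exact mul_left_cancel₀ (by simp [Real.pi_ne_zero]) heq)
    filter_upwards [hae] with p hp using sub_eq_zero.1 hp
  · intro hsymm
    refine PlaneWave.isReciprocal_of_eq hVS hVR hh fun r hr s hs ↦ ?_
    rw [(hrep r hr s hs).2, (hrepT r hr s hs).2]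
    congr 1
    refine integral_congr_ae ?_
    filter_upwards [hsymm] with p hp
    simp only [PlaneWave.waveIntegrand, hp]
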